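/- Let $m,n,t$ be integers with $m\ge 0$ and $1\le t\le n-1$, and let $\mathcal D$ be a data set of $n$ pairs $(r_j,\boldsymbol a_j)\in\mathbb R\times\mathbb R^m$, $1\le j\le n$, with $|r_j|\le\bar r$ and $\|\boldsymbol a_j\|_\infty\le\bar a$ for all $j$. Let $\sigma$ be a uniformly distributed random permutation of $\{1,\dots,n\}$, let $\mathbb E$ be the expectation with respect to $\sigma$, and write $(r_{\sigma(j)},\boldsymbol a_{\sigma(j)})$ for the $j$-th pair in the permuted order, where $a_{i\,\sigma(j)}$ is the $i$-th coordinate of $\boldsymbol a_{\sigma(j)}$. Let $I(\cdot)$ be the indicator function, and let $\boldsymbol p\ge 0$ range over all vectors of $\mathbb R^m$ with nonnegative coordinates. Then $$\mathbb{E}\left[\sup_{\boldsymbol p\ge 0}\left|\frac{1}{n-t}\sum_{j=t+1}^n r_{\sigma(j)}I\big(r_{\sigma(j)}>\boldsymbol a_{\sigma(j)}^\top\boldsymbol p\big)-\frac1t\sum_{j=1}^t r_{\sigma(j)}I\big(r_{\sigma(j)}>\boldsymbol a_{\sigma(j)}^\top\boldsymbol p\big)\right|\right]\le\frac{4\bar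 r}{\sqrt{\min\{t,n-t\}}}+\frac{2\sqrt{2\bar r^2 m\log n}}{\sqrt{\min\{t,n-t\}}},$$ and for every $1\le i\le m$ $$\mathbb{E}\left[\sup_{\boldsymbol p\ge 0}\left|\frac{1}{n-t}\sum_{j=t+1}^n a_{i\,\sigma(j)}I\big(r_{\sigma(j)}>\boldsymbol a_{\sigma(j)}^\top\boldsymbol p\big)-\frac1t\sum_{j=1}^t a_{i\,\sigma(j)}I\big(r_{\sigma(j)}>\boldsymbol a_{\sigma(j)}^\top\boldsymbol p\big)\right|\right]\le\frac{4\bar a}{\sqrt{\min\{t,n-t\}}}+\frac{2\sqrt{2\bar a^2 m\log n}}{\sqrt{\min\{t,n-t\}}}.$$ -/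

import Mathlib

namespace RandomPermutationLP

/-- The expectation of `X σ` for a permutation `σ` of the `n` indices that is uniformly distributed
over all `n!` permutations. -/
noncomputable def permExpectation {n : ℕ} (X : Equiv.Perm (Fin n) → ℝ) : ℝ :=
  (∑ σ : Equiv.Perm (Fin n), X σ) / (n.factorial : ℝ)

/-- The threshold decision `I(r > aᵀp)` for one column `(r, a)` at the dual price `p`. -/
noncomputable def accept {m : ℕ} (r : ℝ) (a p : Fin m → ℝ) : ℝ :=
  if r > a ⬝ᵥ p then 1 else 0

/-- The average of the first `t` terms of `x` (positions are numbered `0, …, n - 1`). -/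
noncomputable def prefixAvg {n : ℕ} (t : ℕ) (x : Fin n → ℝ) : ℝ :=
  1 / (t : ℝ) * ∑ j : Fin n with j.val < t, x j

/-- The average of the last `n - t` terms of `x`. -/
noncomputable def suffixAvg {n : ℕ} (t : ℕ) (x : Fin n → ℝ) : ℝ :=
  1 / ((n : ℝ) - (t : ℝ)) * ∑ j : Fin n with t ≤ j.val, x j

/-- The absolute gap between the suffix and the prefix average of `c_j I(r_j > a_jᵀp)`. -/
noncomputable def gap {m n : ℕ} (t : ℕ) (c r : Fin n → ℝ) (a : Fin n → Fin m → ℝ)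
    (p : Fin m → ℝ) : ℝ :=
  |suffixAvg t (fun j => c j * accept (r j) (a j) p)
    - prefixAvg t (fun j => c j * accept (r j) (a j) p)|

/-- The supremum of the gap over all nonnegative prices `p`. -/
noncomputable def supGap {m n : ℕ} (t : ℕ) (c r : Fin n → ℝ) (a : Fin n → Fin m → ℝ) : ℝ :=
  ⨆ p : {p : Fin m → ℝ // 0 ≤ p}, gap t c r a p.1

/-- The family over which `supGap` is taken is bounded, so that `supGap` is a genuine supremum. -/
theorem bddAbove_gap {m n : ℕ} (t : ℕ) (c r : Fin n → ℝ) (a : Fin n → Fin m → ℝ) :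
    BddAbove (Set.range fun p : {p : Fin m → ℝ // 0 ≤ p} => gap t c r a p.1) := by
  have key : ∀ (s : Finset (Fin n)) (p : Fin m → ℝ),
      |∑ j ∈ s, c j * accept (r j) (a j) p| ≤ ∑ j ∈ s, |c j| := by
    intro s p
    refine (Finset.abs_sum_le_sum_abs _ _).trans (Finset.sum_le_sum fun j _ => ?_)
    unfold accept
    split_ifs <;> simp
  refine ⟨|1 / ((n : ℝ) - (t : ℝ))| * (∑ j : Fin n with t ≤ j.val, |c j|)
    + |1 / (t : ℝ)| * ∑ j : Fin n with j.val < t, |c j|, ?_⟩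
  rintro _ ⟨p, rfl⟩
  refine (abs_sub _ _).trans ?_
  unfold suffixAvg prefixAvg
  rw [abs_mul, abs_mul]
  gcongr <;> exact key _ _

end RandomPermutationLP

/-!
A price `p` affects the averages only through its acceptance pattern `{j | aⱼᵀp < rⱼ}`. If every
subset of `s` is cut out by such a pattern, then no nonzero functional on `ℝˢ` vanishes on the image
of `p ↦ (aⱼᵀp)_{j ∈ s}`, so `#s ≤ m`; by the Sauer-Shelah lemma there are at most `2 n ^ m`
patterns, and the supremum over `p` becomes a maximum of that many absolute values. Say the prefix
is the smaller block. Pair its positions with distinct positions of the suffix: the suffix average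
is the mean, over the permutations of the suffix, of the average over the partners, so by convexity
it suffices to compare two paired blocks of equal size. Swapping the two members of each pair
independently at random preserves the law of `σ` and multiplies the paired differences by Rademacher
signs, for which `cosh x ≤ exp (x ^ 2 / 2)` gives the maximal inequality.
-/

namespace RandomPermutationLP

open Finset
open scoped BigOperators

section VapnikChervonenkis

variable {𝕜 E α : Type*} [Field 𝕜] [LinearOrder 𝕜] [AddCommGroup E] [Module 𝕜 E]

theorem surjective_of_forall_exists_lt_iff [IsStrictOrderedRing 𝕜] [Finite α] (r : α → 𝕜)
    (L : E →ₗ[𝕜] α → 𝕜) (h : ∀ P : α → Prop, ∃ p, ∀ j, L p j < r j ↔ P j) :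
    Function.Surjective L := by
  classical
  cases nonempty_fintype α
  by_contra hL
  obtain ⟨φ, hφ, hrange⟩ := L.range.exists_le_ker_of_lt_top
    (lt_top_iff_ne_top.2 (mt LinearMap.range_eq_top.1 hL))
  -- At a point `p` realizing the pattern `{j | 0 < φ eⱼ}`, all terms of `φ (r - L p) = φ r` are
  -- nonnegative.
  have key (φ : (α → 𝕜) →ₗ[𝕜] 𝕜) (hφL : ∀ p, φ (L p) = 0) :
      0 ≤ φ r ∧ ((∃ j, 0 < φ (Pi.single j 1)) → 0 < φ r) := by
    obtain ⟨p, hp⟩ := h fun j => 0 < φ (Pi.single j 1)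
    have φr_eq : φ r = ∑ j, (r j - L p j) * φ (Pi.single j 1) := by
      rw [← sub_zero (φ r), ← hφL p, ← map_sub, LinearMap.pi_apply_eq_sum_univ φ]
      congr! with j _ i
      simp [Pi.single_apply, eq_comm]
    have term_nonneg (j : α) : 0 ≤ (r j - L p j) * φ (Pi.single j 1) := by
      rcases lt_or_ge 0 (φ (Pi.single j 1)) with hj | hj
      · exact mul_nonneg (sub_nonneg.2 ((hp j).2 hj).le) hj.le
      · exact mul_nonneg_of_nonpos_of_nonpos
          (sub_nonpos.2 (not_lt.1 (mt (hp j).1 hj.not_gt))) hj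
    rw [φr_eq]
    refine ⟨sum_nonneg fun j _ => term_nonneg j, fun ⟨j, hj⟩ => ?_⟩
    exact sum_pos' (fun j _ => term_nonneg j)
      ⟨j, mem_univ j, mul_pos (sub_pos.2 ((hp j).2 hj)) hj⟩
  have hφL (p : E) : φ (L p) = 0 := hrange ⟨p, rfl⟩
  have hpos := key φ hφL
  have hneg := key (-φ) fun p => by simp [hφL p]
  simp only [LinearMap.neg_apply, Left.nonneg_neg_iff, Left.neg_pos_iff] at hneg
  refine hφ (LinearMap.pi_ext' fun j => LinearMap.ext_ring ?_)
  rcases lt_trichotomy (φ (Pi.single j 1)) 0 with hj | hj | hj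
  · exact absurd (hneg.2 ⟨j, hj⟩) hpos.1.not_gt
  · exact hj
  · exact absurd (hpos.2 ⟨j, hj⟩) hneg.1.not_gt

variable [Fintype α]

open Classical in
/-- The family of the strict sublevel sets `{j | (L p) j < r j}` of the linear family `L` below the
threshold `r`. For `L p j = aⱼᵀp` these are the sets of columns accepted at some price `p`. -/
noncomputable def sublevelFamily (r : α → 𝕜) (L : E →ₗ[𝕜] α → 𝕜) : Finset (Finset α) :=
  {s | ∃ p, ({j | L p j < r j} : Finset α) = s}

open Classical in
theorem filter_lt_mem_sublevelFamily (r : α → 𝕜) (L : E →ₗ[𝕜] α → 𝕜) (p : E) :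
    ({j | L p j < r j} : Finset α) ∈ sublevelFamily r L :=
  mem_filter.2 ⟨mem_univ _, p, rfl⟩

theorem sublevelFamily_nonempty (r : α → 𝕜) (L : E →ₗ[𝕜] α → 𝕜) : (sublevelFamily r L).Nonempty :=
  ⟨_, filter_lt_mem_sublevelFamily r L 0⟩

theorem vcDim_sublevelFamily_le_finrank [IsStrictOrderedRing 𝕜] [DecidableEq α]
    [FiniteDimensional 𝕜 E] (r : α → 𝕜) (L : E →ₗ[𝕜] α → 𝕜) :
    (sublevelFamily r L).vcDim ≤ Module.finrank 𝕜 E := by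
  classical
  refine Finset.sup_le fun s hs => ?_
  have hsurj : Function.Surjective (LinearMap.funLeft 𝕜 𝕜 ((↑) : s → α) ∘ₗ L) := by
    refine surjective_of_forall_exists_lt_iff (fun j : s => r j) _ fun P => ?_
    obtain ⟨u, hu, hsu⟩ := mem_shatterer.1 hs (filter_subset (fun j => ∃ hj, P ⟨j, hj⟩) s)
    obtain ⟨p, rfl⟩ := (mem_filter.1 hu).2
    refine ⟨p, fun j => ?_⟩
    simpa using congrArg (fun t => (j : α) ∈ t) hsu
  simpa using LinearMap.finrank_le_finrank_of_surjective hsurj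

theorem sum_Iic_choose_le {n : ℕ} (hn : 2 ≤ n) (d : ℕ) : ∑ i ∈ Iic d, n.choose i ≤ 2 * n ^ d := by
  rw [← Nat.range_succ_eq_Iic]
  induction d with
  | zero => simp
  | succ d ih =>
    rw [sum_range_succ]
    calc _ ≤ 2 * n ^ d + n ^ (d + 1) := add_le_add ih (Nat.choose_le_pow n (d + 1))
      _ ≤ n * n ^ d + n ^ (d + 1) := by gcongr
      _ = 2 * n ^ (d + 1) := by ring

theorem card_le_two_mul_pow_of_vcDim_le [DecidableEq α] {𝒜 : Finset (Finset α)} {d : ℕ}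
    (hα : 2 ≤ Fintype.card α) (h𝒜 : 𝒜.vcDim ≤ d) : #𝒜 ≤ 2 * Fintype.card α ^ d :=
  calc #𝒜 ≤ #𝒜.shatterer := card_le_card_shatterer 𝒜
    _ ≤ ∑ i ∈ Iic 𝒜.vcDim, (Fintype.card α).choose i := card_shatterer_le_sum_vcDim
    _ ≤ ∑ i ∈ Iic d, (Fintype.card α).choose i := by gcongr
    _ ≤ 2 * Fintype.card α ^ d := sum_Iic_choose_le hα d

end VapnikChervonenkis

section Averages

variable {Ω κ V : Type*}

theorem norm_expect_le [SeminormedAddCommGroup V] [NormedSpace ℝ V] [Module ℚ≥0 V] (s : Finset Ω)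
    (x : Ω → V) : ‖𝔼 ω ∈ s, x ω‖ ≤ 𝔼 ω ∈ s, ‖x ω‖ :=
  le_expect_of_subadditive norm_zero norm_add_le fun k v => by
    rw [← NNRat.cast_smul_eq_nnqsmul ℝ, norm_smul, NNRat.smul_def]
    simp

theorem exp_expect_le {s : Finset Ω} (hs : s.Nonempty) (x : Ω → ℝ) :
    Real.exp (𝔼 ω ∈ s, x ω) ≤ 𝔼 ω ∈ s, Real.exp (x ω) := by
  have hcard : (#s : ℝ) ≠ 0 := by exact_mod_cast hs.card_ne_zero
  simpa [expect_eq_sum_div_card, ← mul_sum, div_eq_inv_mul] using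
    convexOn_exp.map_sum_le (t := s) (w := fun _ => (#s : ℝ)⁻¹) (p := x)
      (fun _ _ => by positivity) (by simp [hcard]) fun _ _ => Set.mem_univ _

theorem exists_norm_apply_eq_norm [Fintype κ] [Nonempty κ] [SeminormedAddCommGroup V]
    (x : κ → V) : ∃ y, ‖x y‖ = ‖x‖ := by
  obtain ⟨y, -, hy⟩ := exists_mem_eq_sup univ univ_nonempty fun y => ‖x y‖₊
  exact ⟨y, by rw [Pi.norm_def, hy, coe_nnnorm]⟩

theorem exp_mul_norm_le_sum [Fintype κ] [Nonempty κ] (x : κ → ℝ) (l : ℝ) :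
    Real.exp (l * ‖x‖) ≤ ∑ y, (Real.exp (l * x y) + Real.exp (-l * x y)) := by
  obtain ⟨y, hy⟩ := exists_norm_apply_eq_norm x
  calc Real.exp (l * ‖x‖) = Real.exp (l * |x y|) := by rw [← hy, Real.norm_eq_abs]
    _ ≤ Real.exp (l * x y) + Real.exp (-l * x y) := by
      rcases abs_choice (x y) with h | h <;> rw [h]
      · exact le_add_of_nonneg_right (Real.exp_pos _).le
      · rw [mul_neg, ← neg_mul]
        exact le_add_of_nonneg_left (Real.exp_pos _).le
    _ ≤ _ := single_le_sum (f := fun y => Real.exp (l * x y) + Real.exp (-l * x y))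
      (fun _ _ => by positivity) (mem_univ y)

theorem expect_norm_le_sqrt_of_expect_exp_le [Fintype Ω] [Nonempty Ω] [Fintype κ] [Nonempty κ]
    (X : Ω → κ → ℝ) {v : ℝ}
    (hX : ∀ y l, 𝔼 ω, Real.exp (l * X ω y) ≤ Real.exp (v * l ^ 2 / 2)) :
    𝔼 ω, ‖X ω‖ ≤ √(2 * v * Real.log (2 * Fintype.card κ)) := by
  have hκ : (0 : ℝ) < 2 * Fintype.card κ := by positivity
  have mgf_le (l : ℝ) :
      Real.exp (l * 𝔼 ω, ‖X ω‖) ≤ 2 * Fintype.card κ * Real.exp (v * l ^ 2 / 2) :=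
    calc Real.exp (l * 𝔼 ω, ‖X ω‖) ≤ 𝔼 ω, Real.exp (l * ‖X ω‖) := by
          rw [mul_expect]; exact exp_expect_le univ_nonempty _
      _ ≤ 𝔼 ω, ∑ y, (Real.exp (l * X ω y) + Real.exp (-l * X ω y)) :=
          expect_le_expect fun ω _ => exp_mul_norm_le_sum (X ω) l
      _ = ∑ y, (𝔼 ω, Real.exp (l * X ω y) + 𝔼 ω, Real.exp (-l * X ω y)) := by
          simp only [expect_sum_comm, expect_add_distrib]
      _ ≤ ∑ _y : κ, (Real.exp (v * l ^ 2 / 2) + Real.exp (v * l ^ 2 / 2)) := by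
          gcongr with y
          · exact hX y l
          · simpa only [neg_sq] using hX y (-l)
      _ = 2 * Fintype.card κ * Real.exp (v * l ^ 2 / 2) := by
          rw [sum_const, card_univ, nsmul_eq_mul]; ring
  have quadratic_nonneg (l : ℝ) :
      0 ≤ v / 2 * (l * l) + -(𝔼 ω, ‖X ω‖) * l + Real.log (2 * Fintype.card κ) := by
    have h := Real.log_le_log (Real.exp_pos _) (mgf_le l)
    rw [Real.log_mul hκ.ne' (Real.exp_ne_zero _), Real.log_exp, Real.log_exp] at h
    linarith
  -- The discriminant inequality replaces the choice of an optimal `l`.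
  refine Real.le_sqrt_of_sq_le ?_
  linarith [discrim_le_zero quadratic_nonneg,
    show discrim (v / 2) (-𝔼 ω, ‖X ω‖) (Real.log (2 * Fintype.card κ))
      = (𝔼 ω, ‖X ω‖) ^ 2 - 2 * v * Real.log (2 * Fintype.card κ) by rw [discrim]; ring]

end Averages

section Rademacher

variable {α κ : Type*} [Fintype α] [DecidableEq α]

theorem expect_exp_sum_units_smul_le (d : α → ℝ) :
    𝔼 ε : α → ℤˣ, Real.exp (∑ i, ε i • d i) ≤ Real.exp ((∑ i, d i ^ 2) / 2) :=
  calc 𝔼 ε : α → ℤˣ, Real.exp (∑ i, ε i • d i)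
      = (∑ ε : α → ℤˣ, ∏ i, Real.exp (ε i • d i)) / 2 ^ Fintype.card α := by
        simp [Fintype.expect_eq_sum_div_card, Real.exp_sum]
    _ = ∏ i, Real.cosh (d i) := by
        rw [← Fintype.prod_sum fun i (u : ℤˣ) => Real.exp (u • d i), ← card_univ,
          ← prod_const, ← prod_div_distrib]
        simp [UnitsInt.univ, Real.cosh_eq, Units.smul_def]
    _ ≤ ∏ i, Real.exp (d i ^ 2 / 2) :=
        prod_le_prod (fun i _ => (Real.cosh_pos _).le) fun i _ => Real.cosh_le_exp_half_sq _
    _ = Real.exp ((∑ i, d i ^ 2) / 2) := by rw [← Real.exp_sum, sum_div]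

theorem expect_norm_expect_units_smul_le [Fintype κ] [Nonempty κ] (d : α → κ → ℝ) {b : ℝ}
    (hd : ∀ i, ‖d i‖ ≤ b) :
    𝔼 ε : α → ℤˣ, ‖𝔼 i, ε i • d i‖
      ≤ √(2 * (b ^ 2 / Fintype.card α) * Real.log (2 * Fintype.card κ)) := by
  refine expect_norm_le_sqrt_of_expect_exp_le _ fun y l => ?_
  have sq_le (i : α) : (l * d i y / Fintype.card α) ^ 2 ≤ (l * b / Fintype.card α) ^ 2 := by
    have : |d i y| ≤ |b| := ((norm_le_pi_norm (d i) y).trans (hd i)).trans (le_abs_self b)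
    rw [div_pow, mul_pow, div_pow, mul_pow]
    gcongr ?_ * ?_ / _
    exact sq_le_sq.2 this
  calc 𝔼 ε : α → ℤˣ, Real.exp (l * (𝔼 i, ε i • d i) y)
      = 𝔼 ε : α → ℤˣ, Real.exp (∑ i, ε i • (l * d i y / Fintype.card α)) := by
        refine expect_congr rfl fun ε _ => ?_
        rw [expect_apply, Fintype.expect_eq_sum_div_card, mul_div_assoc', mul_sum, sum_div]
        simp only [Pi.smul_apply, mul_smul_comm, smul_div_assoc]
    _ ≤ Real.exp ((∑ i, (l * d i y / Fintype.card α) ^ 2) / 2) :=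
        expect_exp_sum_units_smul_le _
    _ ≤ Real.exp ((∑ _i : α, (l * b / Fintype.card α) ^ 2) / 2) :=
        Real.exp_le_exp.2 (by linarith [sum_le_sum fun i (_ : i ∈ univ) => sq_le i])
    _ = Real.exp (b ^ 2 / Fintype.card α * l ^ 2 / 2) := by
        rw [sum_const, card_univ, nsmul_eq_mul]
        congr 1
        rcases eq_or_ne (Fintype.card α : ℝ) 0 with h | h
        · simp [h]
        · field_simp

end Rademacher

section Permutations

variable {ι α V : Type*}

theorem expect_expect_mul_right {G Ω M : Type*} [Group G] [Fintype G] [Fintype Ω] [Nonempty Ω]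
    [AddCommMonoid M] [Module ℚ≥0 M] (F : G → M) (g : Ω → G) :
    𝔼 σ, 𝔼 ω, F (σ * g ω) = 𝔼 σ, F σ := by
  rw [expect_comm]
  simp_rw [Fintype.expect_equiv (Equiv.mulRight (g _)) (fun σ => F (σ * g _)) F fun _ => rfl]
  exact Fintype.expect_const _

theorem expect_perm_apply [Fintype ι] [DecidableEq ι] [AddCommMonoid V] [Module ℚ≥0 V]
    (x : ι → V) (b : ι) : 𝔼 τ : Equiv.Perm ι, x (τ b) = 𝔼 i, x i := by
  have : Nonempty ι := ⟨b⟩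
  calc 𝔼 τ : Equiv.Perm ι, x (τ b) = 𝔼 τ : Equiv.Perm ι, 𝔼 i, x (τ i) := by
        simpa using (expect_expect_mul_right (fun τ : Equiv.Perm ι => x (τ b)) (Equiv.swap b)).symm
    _ = 𝔼 i, x i := by
        simp_rw [fun τ : Equiv.Perm ι => Fintype.expect_equiv τ (fun i => x (τ i)) x fun _ => rfl]
        exact Fintype.expect_const _

/-- The permutation of `ι` that swaps `w (i, 1)` and `w (i, -1)` for every `i` with `ε i = -1`. It
is used to introduce random signs into averages over permutations. -/
noncomputable def signFlip (w : α × ℤˣ ↪ ι) (ε : α → ℤˣ) : Equiv.Perm ι :=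
  Equiv.Perm.viaEmbedding (Equiv.prodShear (Equiv.refl α) fun i => Equiv.mulLeft (ε i)) w

theorem signFlip_apply (w : α × ℤˣ ↪ ι) (ε : α → ℤˣ) (i : α) (u : ℤˣ) :
    signFlip w ε (w (i, u)) = w (i, ε i * u) :=
  Equiv.Perm.viaEmbedding_apply _ w (i, u)

theorem signFlip_apply_sub_signFlip_apply [AddCommGroup V] (w : α × ℤˣ ↪ ι) (ε : α → ℤˣ)
    (x : ι → V) (i : α) :
    x (signFlip w ε (w (i, 1))) - x (signFlip w ε (w (i, -1)))
      = ε i • (x (w (i, 1)) - x (w (i, -1))) := by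
  rcases Int.units_eq_one_or (ε i) with h | h <;> simp [signFlip_apply, h, Units.smul_def]

theorem expect_norm_expect_sub_eq_expect_units_smul [Fintype ι] [DecidableEq ι] [Fintype α]
    [DecidableEq α] [SeminormedAddCommGroup V] [Module ℚ≥0 V] (w : α × ℤˣ ↪ ι) (F : ι → V) :
    𝔼 σ : Equiv.Perm ι, ‖𝔼 i, (F (σ (w (i, 1))) - F (σ (w (i, -1))))‖
      = 𝔼 σ : Equiv.Perm ι, 𝔼 ε : α → ℤˣ,
          ‖𝔼 i, ε i • (F (σ (w (i, 1))) - F (σ (w (i, -1))))‖ := by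
  rw [← expect_expect_mul_right _ (signFlip w)]
  refine expect_congr rfl fun σ _ => expect_congr rfl fun ε _ => ?_
  simp only [← signFlip_apply_sub_signFlip_apply w ε fun j => F (σ j), Equiv.Perm.mul_apply]

theorem expect_coe_sort [AddCommMonoid V] [Module ℚ≥0 V] (s : Finset ι) (x : ι → V) :
    𝔼 i : s, x i = 𝔼 i ∈ s, x i := by
  simp only [expect, card_univ, Fintype.card_coe, sum_coe_sort]

variable [Fintype ι] [DecidableEq ι]

theorem exists_pairing_embedding (s : Finset ι) (hs : 2 * #s ≤ Fintype.card ι) :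
    ∃ w : s × ℤˣ ↪ ι, ∀ i, w (i, 1) ∈ sᶜ ∧ w (i, -1) = i := by
  obtain ⟨f⟩ : Nonempty (s ↪ (sᶜ : Finset ι)) :=
    Function.Embedding.nonempty_of_card_le (by simp only [Fintype.card_coe, card_compl]; omega)
  let g (q : s × ℤˣ) : ι := if q.2 = 1 then f q.1 else q.1
  have g_one (i : s) : g (i, 1) = f i := if_pos rfl
  have g_neg_one (i : s) : g (i, -1) = i := if_neg (by simp : (-1 : ℤˣ) ≠ 1)
  have ne (i j : s) : (f i : ι) ≠ j := fun h => mem_compl.1 (f i).2 (h ▸ j.2)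
  refine ⟨⟨g, ?_⟩, fun i => ⟨(g_one i).symm ▸ (f i).2, g_neg_one i⟩⟩
  rintro ⟨i, u⟩ ⟨j, v⟩ h
  rcases Int.units_eq_one_or u with rfl | rfl <;> rcases Int.units_eq_one_or v with rfl | rfl <;>
    simp only [g_one, g_neg_one] at h
  · rw [f.injective (Subtype.ext h)]
  · exact absurd h (ne i j)
  · exact absurd h.symm (ne j i)
  · rw [Subtype.ext h]

theorem expect_compl_sub_expect_eq [AddCommGroup V] [Module ℚ≥0 V] {s : Finset ι}
    (hs : s.Nonempty) {w : s × ℤˣ ↪ ι} (hw : ∀ i, w (i, 1) ∈ sᶜ ∧ w (i, -1) = i) (x : ι → V) :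
    𝔼 j ∈ sᶜ, x j - 𝔼 j ∈ s, x j
      = 𝔼 τ : Equiv.Perm (sᶜ : Finset ι), 𝔼 i,
          (x (τ.ofSubtype (w (i, 1))) - x (τ.ofSubtype (w (i, -1)))) := by
  have : Nonempty s := hs.to_subtype
  have compl_part (i : s) :
      𝔼 τ : Equiv.Perm (sᶜ : Finset ι), x (τ.ofSubtype (w (i, 1))) = 𝔼 j ∈ sᶜ, x j := by
    simp only [Equiv.Perm.ofSubtype_apply_of_mem _ (hw i).1]
    rw [expect_perm_apply (fun j : (sᶜ : Finset ι) => x j), expect_coe_sort]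
  have fixed_part (τ : Equiv.Perm (sᶜ : Finset ι)) (i : s) : τ.ofSubtype (w (i, -1)) = i := by
    rw [(hw i).2, Equiv.Perm.ofSubtype_apply_of_not_mem τ (by simp)]
  simp only [expect_sub_distrib, fixed_part]
  rw [expect_comm, Fintype.expect_const, expect_coe_sort]
  simp only [compl_part, Fintype.expect_const]

variable [SeminormedAddCommGroup V] [NormedSpace ℝ V] [Module ℚ≥0 V]

theorem expect_norm_expect_compl_sub_expect_le {s : Finset ι} (hs : s.Nonempty)
    {w : s × ℤˣ ↪ ι} (hw : ∀ i, w (i, 1) ∈ sᶜ ∧ w (i, -1) = i) (F : ι → V) :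
    𝔼 σ : Equiv.Perm ι, ‖𝔼 j ∈ sᶜ, F (σ j) - 𝔼 j ∈ s, F (σ j)‖
      ≤ 𝔼 σ : Equiv.Perm ι, ‖𝔼 i, (F (σ (w (i, 1))) - F (σ (w (i, -1))))‖ :=
  calc 𝔼 σ : Equiv.Perm ι, ‖𝔼 j ∈ sᶜ, F (σ j) - 𝔼 j ∈ s, F (σ j)‖
      ≤ 𝔼 σ : Equiv.Perm ι, 𝔼 τ : Equiv.Perm (sᶜ : Finset ι), ‖𝔼 i,
          (F ((σ * τ.ofSubtype) (w (i, 1))) - F ((σ * τ.ofSubtype) (w (i, -1))))‖ := by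
        gcongr with σ
        rw [expect_compl_sub_expect_eq hs hw fun j => F (σ j)]
        exact norm_expect_le _ _
    _ = 𝔼 σ : Equiv.Perm ι, ‖𝔼 i, (F (σ (w (i, 1))) - F (σ (w (i, -1))))‖ :=
        expect_expect_mul_right (fun σ : Equiv.Perm ι =>
          ‖𝔼 i, (F (σ (w (i, 1))) - F (σ (w (i, -1))))‖) _

end Permutations

section MaximalInequality

variable {ι κ : Type*} [Fintype ι] [DecidableEq ι] [Fintype κ] [Nonempty κ] {c : ℝ}
  {F : ι → κ → ℝ}

theorem expect_norm_expect_compl_sub_expect_le_sqrt_card (hF : ∀ j, ‖F j‖ ≤ c) {s : Finset ι}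
    (hs : s.Nonempty) (hs2 : 2 * #s ≤ Fintype.card ι) :
    𝔼 σ : Equiv.Perm ι, ‖𝔼 j ∈ sᶜ, F (σ j) - 𝔼 j ∈ s, F (σ j)‖
      ≤ √(2 * ((2 * c) ^ 2 / #s) * Real.log (2 * Fintype.card κ)) := by
  obtain ⟨w, hw⟩ := exists_pairing_embedding s hs2
  have sub_le (i j : ι) : ‖F i - F j‖ ≤ 2 * c := by
    linarith [norm_sub_le (F i) (F j), hF i, hF j]
  calc _ ≤ 𝔼 σ : Equiv.Perm ι, ‖𝔼 i, (F (σ (w (i, 1))) - F (σ (w (i, -1))))‖ :=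
        expect_norm_expect_compl_sub_expect_le hs hw F
    _ = 𝔼 σ : Equiv.Perm ι, 𝔼 ε : s → ℤˣ,
          ‖𝔼 i, ε i • (F (σ (w (i, 1))) - F (σ (w (i, -1))))‖ :=
        expect_norm_expect_sub_eq_expect_units_smul w F
    _ ≤ _ := expect_le univ_nonempty fun σ _ => by
        simpa only [Fintype.card_coe] using
          expect_norm_expect_units_smul_le _ fun i => sub_le (σ (w (i, 1))) (σ (w (i, -1)))

theorem expect_norm_expect_compl_sub_expect_le_sqrt_min_card (hF : ∀ j, ‖F j‖ ≤ c) {s : Finset ι}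
    (hs : s.Nonempty) (hsc : sᶜ.Nonempty) :
    𝔼 σ : Equiv.Perm ι, ‖𝔼 j ∈ sᶜ, F (σ j) - 𝔼 j ∈ s, F (σ j)‖
      ≤ √(2 * ((2 * c) ^ 2 / min (#s : ℝ) #sᶜ) * Real.log (2 * Fintype.card κ)) := by
  have hcard := card_add_card_compl s
  rcases le_total #s #sᶜ with h | h
  · rw [min_eq_left (by exact_mod_cast h)]
    exact expect_norm_expect_compl_sub_expect_le_sqrt_card hF hs (by omega)
  · rw [min_eq_right (by exact_mod_cast h)]
    simpa only [compl_compl, norm_sub_rev] using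
      expect_norm_expect_compl_sub_expect_le_sqrt_card hF hsc (by omega)

end MaximalInequality

section Thresholds

theorem expect_iSup_abs_expect_compl_sub_expect_le {ι E : Type*} [Fintype ι] [DecidableEq ι]
    [AddCommGroup E] [Module ℝ E] (r : ι → ℝ) (L : E →ₗ[ℝ] ι → ℝ) {c : ι → ℝ} {C : ℝ}
    (hc : ∀ j, |c j| ≤ C) {P : Set E} (hP : P.Nonempty) {s : Finset ι} (hs : s.Nonempty)
    (hsc : sᶜ.Nonempty) :
    𝔼 σ : Equiv.Perm ι, ⨆ p : P, |𝔼 j ∈ sᶜ, c (σ j) * (if L p (σ j) < r (σ j) then 1 else 0)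
        - 𝔼 j ∈ s, c (σ j) * (if L p (σ j) < r (σ j) then 1 else 0)|
      ≤ √(2 * ((2 * C) ^ 2 / min (#s : ℝ) #sᶜ) * Real.log (2 * #(sublevelFamily r L))) := by
  classical
  have : Nonempty P := hP.to_subtype
  have : Nonempty (sublevelFamily r L) := (sublevelFamily_nonempty r L).to_subtype
  let F (j : ι) (A : sublevelFamily r L) : ℝ := c j * (if j ∈ A.1 then 1 else 0)
  have norm_F_le (j : ι) : ‖F j‖ ≤ C := by
    refine (pi_norm_le_iff_of_nonneg ((abs_nonneg _).trans (hc j))).2 fun A => ?_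
    refine le_trans ?_ (hc j)
    simp only [F, mul_ite, mul_one, mul_zero, Real.norm_eq_abs]
    split_ifs <;> simp
  calc _ ≤ 𝔼 σ : Equiv.Perm ι, ‖𝔼 j ∈ sᶜ, F (σ j) - 𝔼 j ∈ s, F (σ j)‖ := by
        gcongr with σ
        refine ciSup_le fun p => ?_
        simpa [F] using norm_le_pi_norm (𝔼 j ∈ sᶜ, F (σ j) - 𝔼 j ∈ s, F (σ j))
          ⟨_, filter_lt_mem_sublevelFamily r L p⟩
    _ ≤ _ := by
        simpa only [Fintype.card_coe] using
          expect_norm_expect_compl_sub_expect_le_sqrt_min_card norm_F_le hs hsc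

theorem sqrt_two_mul_log_two_mul_le {C M : ℝ} (hC : 0 ≤ C) (hM : 0 ≤ M) {N n m : ℕ} (hN : 0 < N)
    (hNn : N ≤ 2 * n ^ m) :
    √(2 * ((2 * C) ^ 2 / M) * Real.log (2 * N))
      ≤ 4 * C / √M + 2 * √(2 * C ^ 2 * m * Real.log n) / √M := by
  have log_le : Real.log (2 * N) ≤ 2 + m * Real.log n := by
    have hn : (n : ℝ) ^ m ≠ 0 := by exact_mod_cast (by omega : n ^ m ≠ 0)
    calc Real.log (2 * N) ≤ Real.log (2 ^ 2 * n ^ m) :=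
          Real.log_le_log (by positivity) (by exact_mod_cast (by omega : 2 * N ≤ 2 ^ 2 * n ^ m))
      _ = 2 * Real.log 2 + m * Real.log n := by
          rw [Real.log_mul (by norm_num) hn, Real.log_pow, Real.log_pow, Nat.cast_ofNat]
      _ ≤ 2 + m * Real.log n := by linarith [Real.log_two_lt_d9]
  calc √(2 * ((2 * C) ^ 2 / M) * Real.log (2 * N))
      ≤ √(2 * ((2 * C) ^ 2 / M) * (2 + m * Real.log n)) := by gcongr
    _ = √((4 * C) ^ 2 + (2 * √(2 * C ^ 2 * m * Real.log n)) ^ 2) / √M := by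
        rw [mul_pow 2 (√_), Real.sq_sqrt (by positivity), ← Real.sqrt_div' _ hM]
        congr 1
        ring
    _ ≤ (4 * C + 2 * √(2 * C ^ 2 * m * Real.log n)) / √M := by
        gcongr
        refine Real.sqrt_le_iff.2 ⟨by positivity, ?_⟩
        rw [add_sq]
        linarith [show 0 ≤ 2 * (4 * C) * (2 * √(2 * C ^ 2 * m * Real.log n)) by positivity]
    _ = 4 * C / √M + 2 * √(2 * C ^ 2 * m * Real.log n) / √M := add_div ..

end Thresholds

section Positions

variable {n t : ℕ}

theorem permExpectation_eq_expect (X : Equiv.Perm (Fin n) → ℝ) :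
    permExpectation X = 𝔼 σ, X σ := by
  rw [permExpectation, Fintype.expect_eq_sum_div_card, Fintype.card_perm, Fintype.card_fin]

theorem card_filter_val_lt (htn : t ≤ n) : #({j | j.val < t} : Finset (Fin n)) = t := by
  rw [Fin.card_filter_val_lt, min_eq_right htn]

theorem card_compl_filter_val_lt (htn : t ≤ n) :
    (#({j | j.val < t} : Finset (Fin n))ᶜ : ℝ) = n - t := by
  rw [card_compl, Fintype.card_fin, card_filter_val_lt htn, Nat.cast_sub htn]

theorem prefixAvg_eq_expect (htn : t ≤ n) (x : Fin n → ℝ) :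
    prefixAvg t x = 𝔼 j with j.val < t, x j := by
  rw [prefixAvg, expect_eq_sum_div_card, card_filter_val_lt htn, one_div_mul_eq_div]

theorem suffixAvg_eq_expect_compl (htn : t ≤ n) (x : Fin n → ℝ) :
    suffixAvg t x = 𝔼 j ∈ ({j | j.val < t} : Finset (Fin n))ᶜ, x j := by
  rw [suffixAvg, expect_eq_sum_div_card, card_compl_filter_val_lt htn, one_div_mul_eq_div,
    compl_filter]
  simp only [not_lt]

end Positions

end RandomPermutationLP

open Finset RandomPermutationLP in
theorem proposition2_general {m n t : ℕ} (ht : 1 ≤ t) (htn : t ≤ n - 1) (r : Fin n → ℝ)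
    (a : Fin n → Fin m → ℝ) {c : Fin n → ℝ} {C : ℝ} (hc : ∀ j, |c j| ≤ C)
    {P : Set (Fin m → ℝ)} (hP : P.Nonempty) :
    permExpectation (fun σ : Equiv.Perm (Fin n) =>
        ⨆ p : P, gap t (fun j => c (σ j)) (fun j => r (σ j)) (fun j => a (σ j)) p)
      ≤ 4 * C / √(min (t : ℝ) ((n : ℝ) - (t : ℝ)))
        + 2 * √(2 * C ^ 2 * (m : ℝ) * Real.log (n : ℝ)) / √(min (t : ℝ) ((n : ℝ) - (t : ℝ))) := by
  have t_le : t ≤ n := by omega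
  have t_lt : (t : ℝ) < n := by exact_mod_cast (by omega : t < n)
  let s : Finset (Fin n) := {j | j.val < t}
  have hs : s.Nonempty := ⟨⟨0, by omega⟩, mem_filter.2 ⟨mem_univ _, ht⟩⟩
  have hsc : sᶜ.Nonempty := ⟨⟨t, by omega⟩, by simp [s]⟩
  let L : (Fin m → ℝ) →ₗ[ℝ] Fin n → ℝ := (Matrix.of a).mulVecLin
  have card_le : #(sublevelFamily r L) ≤ 2 * n ^ m := by
    simpa using card_le_two_mul_pow_of_vcDim_le (by rw [Fintype.card_fin]; omega)
      (vcDim_sublevelFamily_le_finrank r L)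
  have bound := expect_iSup_abs_expect_compl_sub_expect_le r L hc hP hs hsc
  rw [card_compl_filter_val_lt t_le, card_filter_val_lt t_le] at bound
  simp only [permExpectation_eq_expect, gap, suffixAvg_eq_expect_compl t_le,
    prefixAvg_eq_expect t_le]
  refine bound.trans (sqrt_two_mul_log_two_mul_le ((abs_nonneg _).trans (hc ⟨0, by omega⟩))
    (le_min (by positivity) (by linarith)) (sublevelFamily_nonempty r L).card_pos card_le)

theorem proposition2 (m n t : ℕ) (ht : 1 ≤ t) (htn : t ≤ n - 1)
    (r : Fin n → ℝ) (a : Fin n → Fin m → ℝ) (rbar abar : ℝ)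
    (hr : ∀ j, |r j| ≤ rbar) (ha : ∀ j, ‖a j‖ ≤ abar) :
    RandomPermutationLP.permExpectation (fun σ : Equiv.Perm (Fin n) =>
        RandomPermutationLP.supGap t (fun j => r (σ j)) (fun j => r (σ j)) (fun j => a (σ j)))
      ≤ 4 * rbar / √(min (t : ℝ) ((n : ℝ) - (t : ℝ)))
        + 2 * √(2 * rbar ^ 2 * (m : ℝ) * Real.log (n : ℝ)) / √(min (t : ℝ) ((n : ℝ) - (t : ℝ)))
    ∧ ∀ i : Fin m,
      RandomPermutationLP.permExpectation (fun σ : Equiv.Perm (Fin n) =>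
          RandomPermutationLP.supGap t (fun j => a (σ j) i) (fun j => r (σ j)) (fun j => a (σ j)))
        ≤ 4 * abar / √(min (t : ℝ) ((n : ℝ) - (t : ℝ)))
          + 2 * √(2 * abar ^ 2 * (m : ℝ) * Real.log (n : ℝ))
            / √(min (t : ℝ) ((n : ℝ) - (t : ℝ))) :=
  ⟨proposition2_general ht htn r a hr Set.nonempty_Ici, fun i =>
    proposition2_general ht htn r a (fun j => (norm_le_pi_norm (a j) i).trans (ha j))
      Set.nonempty_Ici⟩
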